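/- Let $\delta>0$. There is a constant $c_\delta\in(0,\infty)$, depending only on $\delta$, such that the following holds. Let $G$ be a discrete group and let $\psi:G\to[0,\infty)$ be a conditionally negative length: $\psi(e)=0$, $\psi(g)=\psi(g^{-1})$, and $\sum_{g,h}\overline{a_g}a_h\psi(g^{-1}h)\le 0$ for every finite collection of $a_g\in\mathbb C$ with $\sum_g a_g=0$. Let $(h_k)_{k\in I}$ be a finite or infinite sequence in $G$ ($I$ an interval of $\mathbb N$) with $\psi(h_k)>0$ for all $k$ that is $\psi$-lacunary with constant $\delta$: $$\psi(h_{k+1})\ge(1+\delta)\psi(h_k)\quad(k,k+1\in I),\qquad \psi(h_k^{-1}h_{k'})\ge\delta\max\{\psi(h_k),\psi(h_{k'})\}\quad(k\ne k').$$ Let $H$ be a complex Hilbert space, let $c_k\in B(H)$ for $k\in I$, and let $x=\sum_k c_k\otimes\lambda_{h_k}$ be the (formal) Fourier series with these coefficients, where $\lambda$ is the left regular representation of $G$. Then $$c_\delta^{-1}\max\Big\{\Big\|\sum_k|c_k|^2\Big\|,\Big\|\sum_k|c_k^*|^2\Big\|\Big\}\le\|x\|_{BMO(\psi)}^2\le c_\delta\max\Big\{\Big\|\sum_k|c_k|^2\Big\|,\Big\|\sum_k|c_k^*|^2\Big\|\Big\}$$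 as an inequality in $[0,\infty]$. Here $|a|^2=a^*a$; the sums $\sum_k|c_k|^2$ and $\sum_k|c_k^*|^2$ are taken in the strong operator topology, and the norm of a divergent sum is $\infty$. For a Fourier series $x=\sum_g x_g\otimes\lambda_g$ with $x_g\in B(H)$, put $T_tx=\sum_g e^{-t\psi(g)}x_g\otimes\lambda_g$, $x^*=\sum_g x_g^*\otimes\lambda_{g^{-1}}$, $$\|x\|_{BMO_c(\psi)}=\sup_{0<t<\infty}\big\|T_t|x-T_tx|^2\big\|^{1/2},\qquad \|x\|_{BMO(\psi)}=\max\{\|x\|_{BMO_c(\psi)},\|x^*\|_{BMO_c(\psi)}\},$$ where $|y|^2$ has the Fourier coefficients $\sum_g y_g^*y_{gh}$ at $h\in G$, and $\|\cdot\|$ is the norm of $B(H)\overline\otimes\mathcal L(G)\subset B(H\otimes\ell^2(G))$, equal to $\infty$ for a series that is not the Fourier series of an element of this algebra. We put $\|x\|_{BMO_c(\psi)}=\infty$ if $\sum_g\|x_gv\|^2=\infty$ for some $v\in H$ (for $H=\mathbb C$: if $x\notin L^2(\hat G)$). -/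

import Mathlib

open scoped ENNReal NNReal

/-- A conditionally negative length on a (discrete) group `G`. In the last condition the double sum
is automatically real, since `ψ` is symmetric. -/
structure IsCondNegLength {G : Type*} [Group G] (ψ : G → ℝ) : Prop where
  nonneg : ∀ g, 0 ≤ ψ g
  map_one : ψ 1 = 0
  map_inv : ∀ g, ψ g⁻¹ = ψ g
  cond_neg : ∀ (s : Finset G) (a : G → ℂ), ∑ g ∈ s, a g = 0 →
    (∑ g ∈ s, ∑ h ∈ s, (starRingEnd ℂ) (a g) * a h * (ψ (g⁻¹ * h) : ℂ)).re ≤ 0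

/-- `ψ`-lacunarity with constant `δ` of a sequence indexed by a set `I` of natural numbers
(in the theorem, an interval: the sequence is finite or infinite). -/
structure IsLacunary {G : Type*} [Group G] (ψ : G → ℝ) (δ : ℝ) {I : Set ℕ} (h : I → G) : Prop where
  growth : ∀ k l : I, (l : ℕ) = (k : ℕ) + 1 → (1 + δ) * ψ (h k) ≤ ψ (h l)
  separated : ∀ k l : I, k ≠ l → δ * max (ψ (h k)) (ψ (h l)) ≤ ψ ((h k)⁻¹ * h l)

namespace OpFourier

/-! A formal Fourier series `∑ g, x g ⊗ λ_g` with operator coefficients is given by its family of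
coefficients `x : G → B(H)`. -/

section

variable {G : Type*} [Group G] {H : Type*} [NormedAddCommGroup H] [InnerProductSpace ℂ H]

/-- The Fourier multiplier `T_t : λ_g ↦ exp (-t ψ(g)) λ_g`, acting on coefficients. -/
noncomputable def heat {V : Type*} [SMul ℂ V] (ψ : G → ℝ) (t : ℝ) (x : G → V) : G → V :=
  fun g => ((Real.exp (-t * ψ g) : ℝ) : ℂ) • x g

open Classical in
/-- The bounded operator `A` on `ℓ²(G; H) = H ⊗ ℓ²(G)` is `∑ g, a g ⊗ λ_g`, where
`λ_g δ_k = δ_{gk}`: the `(p, q)` entry of the matrix of `A` is `a (p q⁻¹)`. The operators that have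
such a matrix are those that commute with the right translations, i.e. the elements
of the von Neumann algebra `B(H) ⊗ L(G)`. -/
def HasFourierSeries (A : lp (fun _ : G => H) 2 →L[ℂ] lp (fun _ : G => H) 2)
    (a : G → H → H) : Prop :=
  ∀ (p q : G) (v : H), A (lp.single 2 q v) p = a (p * q⁻¹) v

/-- The norm in `B(H) ⊗ L(G)` of the element with Fourier coefficients `a`; it is `∞` if there is
no such element. (There is at most one.) -/
noncomputable def vnNorm (a : G → H → H) : ℝ≥0∞ :=
  ⨅ (A : lp (fun _ : G => H) 2 →L[ℂ] lp (fun _ : G => H) 2) (_ : HasFourierSeries A a), ‖A‖ₑ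

/-- The series is in the column `L²` space: `∑ g, |x g|²` converges weakly, hence strongly.
For `H = ℂ` this is membership in `L²`. -/
def MemColumnL2 (x : G → H →L[ℂ] H) : Prop :=
  ∀ v : H, Summable fun g => ‖x g v‖ ^ 2

variable [CompleteSpace H]

/-- The Fourier coefficients of `|y|² = y* y = ∑ g g', y(g)* y(g') ⊗ λ_{g⁻¹ g'}`; the sum that gives
the coefficient converges strongly for every `y` in the column `L²` space. -/
noncomputable def absSq (y : G → H →L[ℂ] H) : G → H → H :=
  fun h v => ∑' g, ContinuousLinearMap.adjoint (y g) (y (g * h) v)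

/-- The coefficients of the adjoint `x* = ∑ g, (x g)* ⊗ λ_{g⁻¹}`. -/
noncomputable def adj (x : G → H →L[ℂ] H) : G → H →L[ℂ] H :=
  fun g => ContinuousLinearMap.adjoint (x g⁻¹)

open Classical in
/-- The column BMO norm `sup_{t > 0} ‖T_t |x - T_t x|²‖ ^ (1/2)`, with value `∞` outside `L²`. -/
noncomputable def bmoColNorm (ψ : G → ℝ) (x : G → H →L[ℂ] H) : ℝ≥0∞ :=
  if MemColumnL2 x then
    ⨆ (t : ℝ) (_ : 0 < t), vnNorm (heat ψ t (absSq (x - heat ψ t x))) ^ (1 / 2 : ℝ)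
  else ∞

/-- The semigroup BMO norm, with value `∞` if `x` is not in the space `BMO(ψ)`. -/
noncomputable def bmoNorm (ψ : G → ℝ) (x : G → H →L[ℂ] H) : ℝ≥0∞ :=
  max (bmoColNorm ψ x) (bmoColNorm ψ (adj x))

/-- The coefficients of `∑ k, c k ⊗ λ_{h k}`. -/
noncomputable def series {ι : Type*} (c : ι → H →L[ℂ] H) (h : ι → G) : G → H →L[ℂ] H :=
  fun g => ∑ᶠ (k : ι) (_ : h k = g), c k

/-- The operator norm of the sum `∑ k, |b k|²`, `|b|² = b* b`, convergent in the strong operator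
topology; it is `∞` if the sum does not converge. -/
noncomputable def sqSumNorm {ι : Type*} (b : ι → H →L[ℂ] H) : ℝ≥0∞ :=
  ⨅ (S : H →L[ℂ] H)
    (_ : ∀ v, HasSum (fun k => ContinuousLinearMap.adjoint (b k) (b k v)) (S v)), ‖S‖ₑ

end

end OpFourier

/-! The operator `T_t|x - T_t x|²` is `∑ w(g,g') x_g* x_{g'} ⊗ λ_{g⁻¹g'}` with the scalar kernel
`w(g,g') = (1 - e^{-tψ(g)}) (1 - e^{-tψ(g')}) e^{-tψ(g⁻¹g')}`, and both inequalities are read off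
from `w`.

Upper bound: `vnNorm_le_of_schur` bounds the norm by the row sums of `w` times `‖∑ |c_k|²‖`. The
diagonal of `w` is at most 1. Off it, separation with constant `η` gives `w(h_k,h_l) ≤ u_l
e^{-ηu_l}` with `u_l = tψ(h_l)`; as `u` grows geometrically, `sum_mul_exp_le_lacunaryConst` bounds
the row sums uniformly in `t`. The row part needs separation of the inverses `h_k⁻¹` as well. For
both sequences it comes from growth alone, since `√ψ` satisfies the triangle inequality
(`IsCondNegLength.sq_sqrt_sub_sqrt_le`).

Lower bound: the coefficient at the identity is dominated by the norm and equals `∑ (1 -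
e^{-tψ(g)})² |x_g|²`, which increases to `∑ |x_g|²` as `t → ∞` (`tsum_enorm_sq_le_bmoColNorm`). The
constant here is 1. -/

namespace OpFourier

/-! ### Operators into `ℓ²` and the Schur test. -/

section SequenceSpace

variable {ι : Type*} {F : Type*} [NormedAddCommGroup F]

theorem tsum_enorm_sq_lp (f : lp (fun _ : ι => F) 2) : ∑' i, ‖f i‖ₑ ^ 2 = ‖f‖ₑ ^ 2 := by
  have h := lp.hasSum_norm (p := 2) (by norm_num) f
  simp only [ENNReal.toReal_ofNat, Real.rpow_ofNat] at h
  rw [← ofReal_norm, ← ENNReal.ofReal_pow (norm_nonneg _), ← h.tsum_eq,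
    ENNReal.ofReal_tsum_of_nonneg (fun _ => by positivity) h.summable]
  exact tsum_congr fun i => by rw [← ofReal_norm, ← ENNReal.ofReal_pow (norm_nonneg _)]

theorem tsum_enorm_sq_ne_top_iff (f : ι → F) :
    ∑' i, ‖f i‖ₑ ^ 2 ≠ ∞ ↔ Summable fun i => ‖f i‖ ^ 2 := by
  have h : ∀ i, ‖f i‖ₑ ^ 2 = ((‖f i‖₊ ^ 2 : ℝ≥0) : ℝ≥0∞) := fun i => by
    rw [enorm_eq_nnnorm, ENNReal.coe_pow]
  simp_rw [h]
  rw [ENNReal.tsum_coe_ne_top_iff_summable, ← NNReal.summable_coe]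
  simp

theorem memℓp_two_of_tsum_enorm_sq_ne_top {f : ι → F} (hf : ∑' i, ‖f i‖ₑ ^ 2 ≠ ∞) :
    Memℓp f 2 :=
  memℓp_gen (by simpa using (tsum_enorm_sq_ne_top_iff f).1 hf)

variable [NormedSpace ℂ F] {E : Type*} [NormedAddCommGroup E] [NormedSpace ℂ E]

theorem exists_clm_lp (T : E →ₗ[ℂ] ι → F) (C : ℝ≥0)
    (hT : ∀ v, ∑' i, ‖T v i‖ₑ ^ 2 ≤ (C * ‖v‖ₑ) ^ 2) :
    ∃ A : E →L[ℂ] lp (fun _ : ι => F) 2, (∀ v i, A v i = T v i) ∧ ‖A‖ₑ ≤ C := by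
  have hfin : ∀ v, Memℓp (T v) 2 := fun v =>
    memℓp_two_of_tsum_enorm_sq_ne_top
      (ne_top_of_le_ne_top (by simp [ENNReal.mul_eq_top]) (hT v))
  let L : E →ₗ[ℂ] lp (fun _ : ι => F) 2 :=
    { toFun := fun v => ⟨T v, hfin v⟩
      map_add' := fun u v => Subtype.ext (map_add T u v)
      map_smul' := fun c v => Subtype.ext (map_smul T c v) }
  have hL : ∀ v, ‖L v‖ ≤ C * ‖v‖ := fun v => by
    have h := hT v
    have h2 : ∑' i, ‖T v i‖ₑ ^ 2 = ‖L v‖ₑ ^ 2 := tsum_enorm_sq_lp (L v)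
    rw [h2, ENNReal.pow_le_pow_left_iff two_ne_zero] at h
    rw [enorm_eq_nnnorm, enorm_eq_nnnorm] at h
    exact_mod_cast h
  refine ⟨L.mkContinuous C hL, fun v i => rfl, ?_⟩
  have h := L.mkContinuous_norm_le C.2 hL
  rw [enorm_eq_nnnorm]
  exact_mod_cast h

/-- Weighted Cauchy–Schwarz; the spare factor 2 comes from using `xy ≤ x² + y²` on the double sum.
-/
theorem sq_tsum_mul_le (k b : ι → ℝ≥0∞) :
    (∑' j, k j * b j) ^ 2 ≤ 2 * ((∑' j, k j) * ∑' j, k j * b j ^ 2) := by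
  have hb : ∀ x y : ℝ≥0∞, x * y ≤ x ^ 2 + y ^ 2 := fun x y => by
    rcases le_total x y with h | h
    · exact (mul_le_mul_left h y).trans (by rw [← sq]; exact le_add_self)
    · exact (mul_le_mul_right h x).trans (by rw [← sq]; exact le_self_add)
  calc (∑' j, k j * b j) ^ 2 = ∑' i, ∑' j, (k i * b i) * (k j * b j) := by
        simp_rw [sq, ENNReal.tsum_mul_left, ENNReal.tsum_mul_right]
    _ ≤ ∑' i, ∑' j, (k i * b i ^ 2 * k j + k i * (k j * b j ^ 2)) := by
        refine ENNReal.tsum_le_tsum fun i => ENNReal.tsum_le_tsum fun j => ?_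
        calc _ = k i * k j * (b i * b j) := by ring
          _ ≤ k i * k j * (b i ^ 2 + b j ^ 2) := mul_le_mul_right (hb _ _) _
          _ = _ := by ring
    _ = _ := by
        simp_rw [ENNReal.tsum_add, ENNReal.tsum_mul_left, ENNReal.tsum_mul_right]
        ring

/-- The Schur test for a symmetric nonnegative kernel. -/
theorem exists_clm_of_schur [CompleteSpace F] (K : ι → ι → ℝ≥0) (hK : ∀ i j, K i j = K j i)
    (C : ℝ≥0) (hC : ∀ i, ∑' j, (K i j : ℝ≥0∞) ≤ C) :
    ∃ A : lp (fun _ : ι => F) 2 →L[ℂ] lp (fun _ : ι => F) 2,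
      (∀ f i, A f i = ∑' j, ((K i j : ℝ) : ℂ) • f j) ∧ ‖A‖ₑ ≤ 2 * C := by
  have hsq : ∀ f : lp (fun _ : ι => F) 2,
      ∑' i, (∑' j, (K i j : ℝ≥0∞) * ‖f j‖ₑ) ^ 2 ≤ (2 * C * ‖f‖ₑ) ^ 2 := fun f => by
    calc ∑' i, (∑' j, (K i j : ℝ≥0∞) * ‖f j‖ₑ) ^ 2
        ≤ ∑' i, 2 * (C * ∑' j, (K i j : ℝ≥0∞) * ‖f j‖ₑ ^ 2) := by
          refine ENNReal.tsum_le_tsum fun i => (sq_tsum_mul_le _ _).trans ?_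
          gcongr
          exact hC i
      _ = 2 * (C * ∑' j, (∑' i, (K j i : ℝ≥0∞)) * ‖f j‖ₑ ^ 2) := by
          rw [ENNReal.tsum_mul_left, ENNReal.tsum_mul_left, ENNReal.tsum_comm]
          simp_rw [ENNReal.tsum_mul_right, fun j i => hK i j]
      _ ≤ 2 * (C * ∑' j, C * ‖f j‖ₑ ^ 2) := by
          gcongr with j
          exact hC j
      _ = 2 * (C ^ 2 * ‖f‖ₑ ^ 2) := by
          rw [ENNReal.tsum_mul_left, tsum_enorm_sq_lp]; ring
      _ ≤ 4 * (C ^ 2 * ‖f‖ₑ ^ 2) := by gcongr; norm_num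
      _ = _ := by ring
  have henorm : ∀ (f : lp (fun _ : ι => F) 2) i j,
      ‖((K i j : ℝ) : ℂ) • f j‖ₑ = (K i j : ℝ≥0∞) * ‖f j‖ₑ := fun f i j => by
    rw [enorm_smul, enorm_eq_nnnorm]
    congr 2
    ext; simp
  have hsum : ∀ (f : lp (fun _ : ι => F) 2) i,
      Summable fun j => ((K i j : ℝ) : ℂ) • f j := fun f i => by
    refine Summable.of_enorm ?_
    simp_rw [henorm]
    intro h
    have h1 := (ENNReal.le_tsum i).trans (hsq f)
    rw [h] at h1
    simp [ENNReal.mul_eq_top] at h1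
  let T : lp (fun _ : ι => F) 2 →ₗ[ℂ] ι → F :=
    { toFun := fun f i => ∑' j, ((K i j : ℝ) : ℂ) • f j
      map_add' := fun f g => by
        ext i
        simp only [lp.coeFn_add, Pi.add_apply, smul_add]
        exact (hsum f i).tsum_add (hsum g i)
      map_smul' := fun c f => by
        ext i
        simp only [lp.coeFn_smul, Pi.smul_apply, RingHom.id_apply, smul_comm _ c]
        exact tsum_const_smul'' c }
  obtain ⟨A, hA, hn⟩ := exists_clm_lp T (2 * C) fun f => by
    refine le_trans (ENNReal.tsum_le_tsum fun i => ?_) ((hsq f).trans_eq (by push_cast; rfl))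
    gcongr
    refine (enorm_tsum_le_tsum_enorm).trans_eq (tsum_congr fun j => henorm f i j)
  exact ⟨A, hA, by simpa using hn⟩

end SequenceSpace

/-! ### Column operators and their adjoints. -/

section Column

open ContinuousLinearMap

variable {ι : Type*} {H : Type*} [NormedAddCommGroup H] [InnerProductSpace ℂ H] [CompleteSpace H]

theorem exists_column_of_summable (y : ι → H →L[ℂ] H)
    (hy : ∀ v, Summable fun i => ‖y i v‖ ^ 2) :
    ∃ Y : H →L[ℂ] lp (fun _ : ι => H) 2, ∀ v i, Y v i = y i v := by
  let L : H →ₗ[ℂ] lp (fun _ : ι => H) 2 :=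
    { toFun := fun v => ⟨fun i => y i v, memℓp_gen (by simpa using hy v)⟩
      map_add' := fun u v => Subtype.ext (funext fun i => map_add (y i) u v)
      map_smul' := fun c v => Subtype.ext (funext fun i => map_smul (y i) c v) }
  -- The hypothesis is only pointwise in `v`; boundedness is the closed graph theorem.
  refine ⟨⟨L, L.continuous_of_seq_closed_graph fun u v w hu hw => ?_⟩, fun v i => rfl⟩
  ext i
  have h1 := ((lp.evalCLM ℂ (fun _ : ι => H) 2 i).continuous.tendsto w).comp hw
  have h2 := ((y i).continuous.tendsto v).comp hu
  exact tendsto_nhds_unique h1 h2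

theorem hasSum_adjoint_column {y : ι → H →L[ℂ] H} {Y : H →L[ℂ] lp (fun _ : ι => H) 2}
    (hY : ∀ v i, Y v i = y i v) (f : lp (fun _ : ι => H) 2) :
    HasSum (fun i => adjoint (y i) (f i)) (adjoint Y f) := by
  classical
  have h := (lp.hasSum_single (p := 2) (by norm_num) f).map (adjoint Y) (adjoint Y).continuous
  convert h using 1
  ext i
  refine ext_inner_left ℂ fun v => ?_
  simp only [Function.comp_apply, adjoint_inner_right]
  rw [lp.inner_single_right, hY]

end Column

section Schur

open ContinuousLinearMap

variable {G : Type*} {H : Type*} [NormedAddCommGroup H] [InnerProductSpace ℂ H] [CompleteSpace H]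

/-- Expand `f` in its one-point pieces: `X*` sends the piece at `(g, q)` to a vector supported at
`q`, so only the pieces with `q = p` contribute. -/
theorem hasSum_adjoint_columns {x : G → H →L[ℂ] H}
    {X : lp (fun _ : G => H) 2 →L[ℂ] lp (fun _ : G × G => H) 2}
    (hX : ∀ f i, X f i = x i.1 (f i.2)) (f : lp (fun _ : G × G => H) 2) (p : G) :
    HasSum (fun g => adjoint (x g) (f (g, p))) (adjoint X f p) := by
  classical
  have h := (lp.hasSum_single (p := 2) (by norm_num) f).map
    ((lp.evalCLM ℂ (fun _ : G => H) 2 p).comp (adjoint X)) (ContinuousLinearMap.continuous _)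
  have key : ∀ i : G × G, ((lp.evalCLM ℂ (fun _ : G => H) 2 p).comp (adjoint X))
      (lp.single 2 i (f i)) = if i.2 = p then adjoint (x i.1) (f i) else 0 := fun i => by
    refine ext_inner_left ℂ fun w => ?_
    refine (lp.inner_single_left (𝕜 := ℂ) (G := fun _ : G => H) p w
      (adjoint X (lp.single 2 i (f i)))).symm.trans ?_
    rw [adjoint_inner_right, lp.inner_single_right, hX,
      lp.single_apply]
    split_ifs with hi
    · subst hi
      rw [Pi.single_eq_same, adjoint_inner_right]
    · rw [Pi.single_eq_of_ne hi]; simp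
  have hinj : Function.Injective fun g : G => (g, p) := fun g g' h => (Prod.ext_iff.1 h).1
  rw [← hinj.hasSum_iff] at h
  · have hval : ((lp.evalCLM ℂ (fun _ : G => H) 2 p).comp (adjoint X)) f = adjoint X f p := rfl
    rw [hval] at h
    convert h using 1
    ext g
    exact ((key (g, p)).trans (if_pos rfl)).symm
  · rintro ⟨g, q⟩ hq
    simp only [Function.comp_apply]
    rw [key, if_neg]
    rintro rfl
    exact hq ⟨g, rfl⟩

theorem enorm_adjoint_comp_comp_le {E F : Type*} [NormedAddCommGroup E] [InnerProductSpace ℂ E]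
    [CompleteSpace E] [NormedAddCommGroup F] [InnerProductSpace ℂ F] [CompleteSpace F]
    (X : E →L[ℂ] F) (B : F →L[ℂ] F) :
    ‖(adjoint X).comp (B.comp X)‖ₑ ≤ ‖X‖ₑ * (‖B‖ₑ * ‖X‖ₑ) := by
  have h : ‖adjoint X‖ = ‖X‖ := (adjoint (𝕜 := ℂ)).norm_map X
  have h1 : ‖(adjoint X).comp (B.comp X)‖ ≤ ‖X‖ * (‖B‖ * ‖X‖) := by
    refine (opNorm_comp_le _ _).trans ?_
    rw [h]
    exact mul_le_mul_of_nonneg_left (opNorm_comp_le _ _) (norm_nonneg _)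
  rw [← ofReal_norm, ← ofReal_norm, ← ofReal_norm, ← ENNReal.ofReal_mul (norm_nonneg _),
    ← ENNReal.ofReal_mul (norm_nonneg _)]
  exact ENNReal.ofReal_le_ofReal h1

end Schur

variable {G : Type*} [Group G] {H : Type*} [NormedAddCommGroup H] [InnerProductSpace ℂ H]
  [CompleteSpace H]

open ContinuousLinearMap in
/-- Off-diagonal damping by a Schur multiplier preserves boundedness of `x* x`. -/
theorem vnNorm_le_of_schur {x : G → H →L[ℂ] H} {M : ℝ≥0}
    (hx : ∀ v, ∑' g, ‖x g v‖ₑ ^ 2 ≤ (M * ‖v‖ₑ) ^ 2)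
    (K : G → G → ℝ≥0) (hK : ∀ g g', K g g' = K g' g)
    {C : ℝ≥0} (hC : ∀ g, ∑' g', (K g g' : ℝ≥0∞) ≤ C) {a : G → H → H}
    (ha : ∀ h v, a h v = ∑' g, ((K g (g * h) : ℝ) : ℂ) • adjoint (x g) (x (g * h) v)) :
    vnNorm a ≤ 2 * C * M ^ 2 := by
  classical
  -- `X = ∑ x_g ⊗ e_g` as a column acting on each fibre `p`. The operator sought is `X* B X`, where
  -- `B` is the Schur kernel below.
  obtain ⟨X, hX, hXn⟩ := exists_clm_lp
    (T := ({ toFun := fun f i => x i.1 (f i.2)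
             map_add' := fun f g => by ext i; simp
             map_smul' := fun c f => by ext i; simp } :
      lp (fun _ : G => H) 2 →ₗ[ℂ] G × G → H)) M (fun f => by
        simp only [LinearMap.coe_mk, AddHom.coe_mk]
        rw [ENNReal.tsum_prod (f := fun g p => ‖x g (f p)‖ₑ ^ 2), ENNReal.tsum_comm]
        refine (ENNReal.tsum_le_tsum fun p => hx (f p)).trans_eq ?_
        simp_rw [mul_pow]
        rw [ENNReal.tsum_mul_left, tsum_enorm_sq_lp])
  simp only [LinearMap.coe_mk, AddHom.coe_mk] at hX
  -- The constraint `gp = g'q` encodes `λ_{g⁻¹g'}`. Given `(g, p)` and `g'` it determines `q`, so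
  -- the row sums are those of `K`.
  obtain ⟨B, hB, hBn⟩ := exists_clm_of_schur (F := H)
    (fun i j : G × G => if i.1 * i.2 = j.1 * j.2 then K i.1 j.1 else 0)
    (fun i j => by simp only [eq_comm, hK i.1]) C (fun i => by
      refine le_trans (le_of_eq ?_) (hC i.1)
      rw [ENNReal.tsum_prod (f := fun g q =>
        ((if i.1 * i.2 = g * q then K i.1 g else 0 : ℝ≥0) : ℝ≥0∞))]
      refine tsum_congr fun g => ?_
      rw [tsum_eq_single (g⁻¹ * (i.1 * i.2))]
      · simp
      · intro q hq
        rw [if_neg, ENNReal.coe_zero]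
        rintro h
        exact hq (by rw [h]; group))
  have hA : HasFourierSeries ((adjoint X).comp (B.comp X)) a := fun p q v => by
    rw [comp_apply, comp_apply, ← (hasSum_adjoint_columns hX _ p).tsum_eq, ha]
    refine tsum_congr fun g => ?_
    rw [hB, tsum_eq_single (g * (p * q⁻¹), q), hX]
    · simp [mul_assoc]
    · rintro ⟨g', q'⟩ hne
      rw [hX]
      by_cases hq : q' = q
      · subst hq
        simp only
        rw [if_neg]
        · simp
        · intro h
          exact hne (Prod.ext (by rw [← mul_assoc, h]; simp) rfl)
      · simp [lp.single_apply, Pi.single_eq_of_ne hq]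
  refine (iInf₂_le (f := fun A (_ : HasFourierSeries A a) => ‖A‖ₑ) _ hA).trans ?_
  calc _ ≤ (M : ℝ≥0∞) * (2 * C * M) := by
        refine (enorm_adjoint_comp_comp_le X B).trans ?_
        gcongr
    _ = _ := by ring

/-- The coefficient of `|y|²` at the identity is bounded by the norm. -/
theorem tsum_enorm_sq_le_vnNorm {ψ : G → ℝ} (hψ : ψ 1 = 0) (t : ℝ) {y : G → H →L[ℂ] H}
    (hy : MemColumnL2 y) (v : H) :
    ∑' g, ‖y g v‖ₑ ^ 2 ≤ vnNorm (heat ψ t (absSq y)) * ‖v‖ₑ ^ 2 := by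
  classical
  obtain ⟨Y, hY⟩ := exists_column_of_summable y hy
  have hYY : ∑' g, ‖y g v‖ₑ ^ 2 = ‖Y v‖ₑ ^ 2 := by
    rw [← tsum_enorm_sq_lp]; simp_rw [hY]
  rcases eq_or_ne v 0 with rfl | hv
  · simp
  rw [hYY, ← ENNReal.div_le_iff (by simpa using hv) (by simp)]
  refine le_iInf₂ fun A hA => ?_
  rw [ENNReal.div_le_iff (by simpa using hv) (by simp)]
  -- The `(1, 1)` entry of the matrix is `Y* Y`; damping does not change it because `ψ 1 = 0`.
  have h1 : A (lp.single 2 1 v) 1 = ContinuousLinearMap.adjoint Y (Y v) := by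
    rw [← (hasSum_adjoint_column hY (Y v)).tsum_eq]
    have h := hA 1 1 v
    simp only [heat, absSq, inv_one, mul_one, hψ, mul_zero, Real.exp_zero, Complex.ofReal_one,
      Pi.smul_apply, one_smul] at h
    convert h using 4
    rw [hY]
  have h2 : ‖Y v‖ ^ 2 ≤ ‖A‖ * ‖v‖ ^ 2 := by
    calc ‖Y v‖ ^ 2 = ‖inner ℂ v (A (lp.single 2 1 v) 1)‖ := by
          rw [h1, ContinuousLinearMap.adjoint_inner_right, inner_self_eq_norm_sq_to_K]
          simp
      _ ≤ ‖v‖ * ‖A (lp.single 2 1 v) 1‖ := norm_inner_le_norm _ _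
      _ ≤ ‖v‖ * (‖A‖ * ‖v‖) := by
          gcongr
          refine (lp.norm_apply_le_norm (by norm_num) _ _).trans ((A.le_opNorm _).trans_eq ?_)
          rw [lp.norm_single (by norm_num)]
      _ = _ := by ring
  simp only [enorm_eq_nnnorm]
  exact_mod_cast h2

end OpFourier

/-! ### The geometry of `√ψ` and lacunary sums. -/

/-- Conditional negativity is tested on the three points `1`, `g`, `k`. -/
theorem IsCondNegLength.sq_sqrt_sub_sqrt_le {G : Type*} [Group G] {ψ : G → ℝ}
    (hψ : IsCondNegLength ψ) {g k : G} (hg : 0 < ψ g) (hk : 0 < ψ k) :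
    (√(ψ g) - √(ψ k)) ^ 2 ≤ ψ (g⁻¹ * k) := by
  classical
  have hp := Real.sqrt_pos.2 hg
  have hq := Real.sqrt_pos.2 hk
  have hp2 := Real.sq_sqrt hg.le
  have hq2 := Real.sq_sqrt hk.le
  set p := √(ψ g)
  set q := √(ψ k)
  rcases eq_or_ne g k with rfl | hgk
  · simp [p, q, hψ.map_one]
  have hg1 : g ≠ 1 := by rintro rfl; simp [hψ.map_one] at hg
  have hk1 : k ≠ 1 := by rintro rfl; simp [hψ.map_one] at hk
  have hkg : ψ (k⁻¹ * g) = ψ (g⁻¹ * k) := by rw [← hψ.map_inv]; simp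
  have hs : ∀ f : G → ℂ, ∑ x ∈ ({1, g, k} : Finset G), f x = f 1 + (f g + f k) := fun f => by
    rw [Finset.sum_insert (by simp [hg1.symm, hk1.symm]), Finset.sum_insert (by simpa using hgk),
      Finset.sum_singleton]
  -- With weights `p - q`, `q`, `-p` the form equals `2pq((p - q)² - ψ(g⁻¹k))`.
  have h := hψ.cond_neg {1, g, k}
    (fun x => ((if x = 1 then p - q else if x = g then q else -p : ℝ) : ℂ))
    (by rw [hs]; simp [hg1, hk1, hgk.symm]; ring)
  rw [hs] at h
  simp only [hs, hg1, hk1, hgk.symm, if_true, if_false, inv_one, one_mul, mul_one,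
    inv_mul_cancel, hψ.map_one, hψ.map_inv, hkg, Complex.conj_ofReal] at h
  have h' : p * q * (p - q) ^ 2 ≤ p * q * ψ (g⁻¹ * k) := by
    norm_cast at h
    nlinarith [h]
  exact le_of_mul_le_mul_left h' (mul_pos hp hq)

/-- Since `√ψ` satisfies the triangle inequality, lacunary growth implies separation. -/
theorem IsCondNegLength.separated_of_growth {G ι : Type*} [Group G] [LinearOrder ι] {ψ : G → ℝ}
    (hψ : IsCondNegLength ψ) {δ : ℝ} (hδ : 0 < δ) {h : ι → G} (hpos : ∀ k, 0 < ψ (h k))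
    (hgrow : ∀ k l, k < l → (1 + δ) * ψ (h k) ≤ ψ (h l)) {k l : ι} (hkl : k ≠ l) :
    (1 - (√(1 + δ))⁻¹) ^ 2 * ψ (h l) ≤ ψ ((h k)⁻¹ * h l) := by
  have key : ∀ k l, k < l → (1 - (√(1 + δ))⁻¹) ^ 2 * ψ (h l) ≤ ψ ((h k)⁻¹ * h l) :=
    fun k l hlt => by
      refine le_trans ?_ (hψ.sq_sqrt_sub_sqrt_le (hpos k) (hpos l))
      have hr : 1 < √(1 + δ) := by rw [Real.lt_sqrt] <;> linarith
      have h1 : √(1 + δ) * √(ψ (h k)) ≤ √(ψ (h l)) := by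
        rw [← Real.sqrt_mul (by linarith)]
        exact Real.sqrt_le_sqrt (hgrow k l hlt)
      have h2 : √(ψ (h k)) ≤ (√(1 + δ))⁻¹ * √(ψ (h l)) := by
        rw [← div_eq_inv_mul, le_div_iff₀ (by linarith)]
        linarith
      have h3 : (√(1 + δ))⁻¹ < 1 := inv_lt_one_of_one_lt₀ hr
      have h4 := Real.sqrt_nonneg (ψ (h l))
      calc (1 - (√(1 + δ))⁻¹) ^ 2 * ψ (h l) = ((1 - (√(1 + δ))⁻¹) * √(ψ (h l))) ^ 2 := by
            rw [mul_pow, Real.sq_sqrt (hpos l).le]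
        _ ≤ (√(ψ (h l)) - √(ψ (h k))) ^ 2 :=
            pow_le_pow_left₀ (mul_nonneg (by linarith) h4) (by linarith) 2
        _ = _ := by ring
  rcases lt_or_gt_of_ne hkl with hlt | hlt
  · exact key k l hlt
  · refine le_trans ?_ ((key l k hlt).trans_eq ?_)
    · gcongr
      nlinarith [hgrow l k hlt, hpos l]
    · rw [← hψ.map_inv]; simp

/-- A uniform bound for `∑ u e^{-ηu}` along a sequence growing with ratio `1 + δ`. -/
noncomputable def lacunaryConst (δ η : ℝ) : ℝ := (1 + δ) / (δ * min 1 (η / 2) ^ 2)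

theorem lacunaryConst_nonneg {δ : ℝ} (hδ : 0 < δ) (η : ℝ) : 0 ≤ lacunaryConst δ η := by
  unfold lacunaryConst; positivity

theorem mul_exp_le_telescope {δ η s : ℝ} (hδ : 0 < δ) (hη : 0 < η) (hs : 0 ≤ s) :
    s * Real.exp (-(η * s)) ≤
      lacunaryConst δ η * ((1 + δ) * s / (1 + (1 + δ) * s) - s / (1 + s)) := by
  have hm : 0 < min 1 (η / 2) := lt_min one_pos (by linarith)
  have hm1 : min 1 (η / 2) ≤ 1 := min_le_left _ _
  have hm2 : min 1 (η / 2) ≤ η / 2 := min_le_right _ _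
  unfold lacunaryConst
  set m := min 1 (η / 2)
  -- Both bounds on `m` enter here: `m + ms ≤ 1 + ηs/2`.
  have h1 : m * (1 + s) ≤ Real.exp (η * s / 2) := by
    have := Real.add_one_le_exp (η * s / 2)
    nlinarith
  have h2 : (m * (1 + s)) ^ 2 ≤ Real.exp (η * s) := by
    calc _ ≤ Real.exp (η * s / 2) ^ 2 := by gcongr
      _ = _ := by rw [← Real.exp_nat_mul]; congr 1; push_cast; ring
  have h3 : (1 + δ) / (δ * m ^ 2) * ((1 + δ) * s / (1 + (1 + δ) * s) - s / (1 + s)) =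
      s * ((1 + δ) / (m ^ 2 * (1 + s) * (1 + (1 + δ) * s))) := by
    field_simp
    ring
  rw [h3]
  refine mul_le_mul_of_nonneg_left ?_ hs
  rw [Real.exp_neg, ← one_div, div_le_div_iff₀ (Real.exp_pos _) (by positivity)]
  calc 1 * (m ^ 2 * (1 + s) * (1 + (1 + δ) * s))
      ≤ (1 + δ) * (m * (1 + s)) ^ 2 := by
        have : 1 + (1 + δ) * s ≤ (1 + δ) * (1 + s) := by nlinarith
        calc _ ≤ m ^ 2 * (1 + s) * ((1 + δ) * (1 + s)) := by rw [one_mul]; gcongr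
          _ = _ := by ring
    _ ≤ _ := by gcongr

/-- Each term is dominated by an increment of `s/(1 + s)` over `[u_k, (1+δ)u_k]`. These intervals do
not overlap, so the increments add up to at most 1. -/
theorem sum_mul_exp_le_lacunaryConst {ι : Type*} [LinearOrder ι] {δ η : ℝ} (hδ : 0 < δ)
    (hη : 0 < η) {u : ι → ℝ} (hu : ∀ k, 0 ≤ u k) (hgrow : ∀ k l, k < l → (1 + δ) * u k ≤ u l)
    (s : Finset ι) : ∑ k ∈ s, u k * Real.exp (-(η * u k)) ≤ lacunaryConst δ η := by
  have hC := lacunaryConst_nonneg hδ η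
  have hmono : ∀ a b : ℝ, 0 ≤ a → a ≤ b → a / (1 + a) ≤ b / (1 + b) := fun a b ha hab => by
    rw [div_le_div_iff₀ (by linarith) (by linarith)]
    nlinarith
  have key : ∀ b : ℝ, 0 ≤ b → (∀ k ∈ s, (1 + δ) * u k ≤ b) →
      ∑ k ∈ s, u k * Real.exp (-(η * u k)) ≤ lacunaryConst δ η * (b / (1 + b)) := by
    induction s using Finset.induction_on_max with
    | empty => intro b hb _; simp only [Finset.sum_empty]; positivity
    | insert a s ha ih =>
      intro b hb hle
      rw [Finset.sum_insert fun h => lt_irrefl _ (ha a h)]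
      have h1 := ih (u a) (hu a) fun k hk => hgrow k a (ha k hk)
      have h2 := mul_exp_le_telescope hδ hη (hu a)
      have h3 := mul_le_mul_of_nonneg_left (hmono _ _ (mul_nonneg (by linarith) (hu a))
        (hle a (Finset.mem_insert_self a s))) hC
      linarith
  -- Any common upper bound of the `(1 + δ) u_k` would do for `b`; the sum is one.
  have hb : 0 ≤ ∑ k ∈ s, (1 + δ) * u k :=
    Finset.sum_nonneg fun k _ => mul_nonneg (by linarith) (hu k)
  refine (key _ hb fun k hk =>
    Finset.single_le_sum (f := fun k => (1 + δ) * u k)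
      (fun k _ => mul_nonneg (by linarith) (hu k)) hk).trans ?_
  refine mul_le_of_le_one_right hC ?_
  rw [div_le_one (by linarith)]
  linarith

theorem IsLacunary.growth_of_lt {G : Type*} [Group G] {ψ : G → ℝ} {δ : ℝ} (hδ : 0 < δ)
    {I : Set ℕ} (hI : I.OrdConnected) {h : I → G} (hlac : IsLacunary ψ δ h)
    (hpos : ∀ k, 0 < ψ (h k)) (k l : I) (hkl : k < l) : (1 + δ) * ψ (h k) ≤ ψ (h l) := by
  have key : ∀ n (hn : n ∈ I), (k : ℕ) + 1 ≤ n → (1 + δ) * ψ (h k) ≤ ψ (h ⟨n, hn⟩) := by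
    intro n hn hkn
    induction n, hkn using Nat.le_induction with
    | base => exact hlac.growth k ⟨_, hn⟩ rfl
    | succ n hkn ih =>
      have hn' : n ∈ I := hI.out k.2 hn ⟨by omega, by omega⟩
      have h1 := hlac.growth ⟨n, hn'⟩ ⟨n + 1, hn⟩ rfl
      nlinarith [ih hn', hpos ⟨n, hn'⟩]
  exact key l l.2 (Nat.succ_le_of_lt hkl)

/-! ### The two bounds for lacunary series. -/

namespace OpFourier

section Series

variable {G ι : Type*} {H : Type*} [NormedAddCommGroup H] [InnerProductSpace ℂ H]

theorem series_apply {h : ι → G} (hinj : Function.Injective h) (c : ι → H →L[ℂ] H) (k : ι) :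
    series c h (h k) = c k := by
  have hl : ∀ l, l ≠ k → ∑ᶠ (_ : h l = h k), c l = 0 := fun l hl =>
    haveI : IsEmpty (h l = h k) := ⟨fun e => hl (hinj e)⟩
    finsum_of_isEmpty _
  rw [series, finsum_eq_single _ k hl]
  simp

theorem series_of_notMem_range {h : ι → G} (c : ι → H →L[ℂ] H) {g : G} (hg : g ∉ Set.range h) :
    series c h g = 0 := by
  have hk : ∀ k, ∑ᶠ (_ : h k = g), c k = 0 := fun k =>
    haveI : IsEmpty (h k = g) := ⟨fun e => hg ⟨k, e⟩⟩
    finsum_of_isEmpty _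
  simp only [series, hk, finsum_zero]

theorem tsum_enorm_series {h : ι → G} (hinj : Function.Injective h) (c : ι → H →L[ℂ] H) (v : H) :
    ∑' g, ‖series c h g v‖ₑ ^ 2 = ∑' k, ‖c k v‖ₑ ^ 2 := by
  rw [← hinj.tsum_eq]
  · simp_rw [series_apply hinj]
  · intro g hg
    by_contra hr
    simp [series_of_notMem_range c hr] at hg

theorem sub_heat_apply (ψ : G → ℝ) (t : ℝ) (x : G → H →L[ℂ] H) (g : G) :
    (x - heat ψ t x) g = ((1 - Real.exp (-t * ψ g) : ℝ) : ℂ) • x g := by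
  simp only [heat, Pi.sub_apply]
  push_cast
  rw [sub_smul, one_smul]

theorem MemColumnL2.sub_heat {ψ : G → ℝ} (hψ : ∀ g, 0 ≤ ψ g) {t : ℝ} (ht : 0 < t)
    {x : G → H →L[ℂ] H} (hx : MemColumnL2 x) : MemColumnL2 (x - heat ψ t x) := fun v => by
  refine (hx v).of_nonneg_of_le (fun _ => by positivity) fun g => ?_
  rw [sub_heat_apply, smul_apply, norm_smul, Complex.norm_real]
  have h1 : Real.exp (-t * ψ g) ≤ 1 := Real.exp_le_one_iff.2 (by nlinarith [hψ g])
  have h2 := Real.exp_pos (-t * ψ g)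
  rw [Real.norm_of_nonneg (by linarith)]
  gcongr
  exact mul_le_of_le_one_left (norm_nonneg _) (by linarith)

variable [Group G] [CompleteSpace H]

theorem adj_series {h : ι → G} (hinj : Function.Injective h) (c : ι → H →L[ℂ] H) :
    adj (series c h) =
      series (fun k => ContinuousLinearMap.adjoint (c k)) (fun k => (h k)⁻¹) := by
  have hinj' : Function.Injective fun k => (h k)⁻¹ := inv_injective.comp hinj
  ext1 g
  unfold adj
  by_cases hg : g⁻¹ ∈ Set.range h
  · obtain ⟨k, hk⟩ := hg
    obtain rfl : (h k)⁻¹ = g := by rw [hk, inv_inv]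
    rw [inv_inv, series_apply hinj]
    exact (series_apply hinj' (fun k => ContinuousLinearMap.adjoint (c k)) k).symm
  · rw [series_of_notMem_range c hg, map_zero, series_of_notMem_range _ ?_]
    rintro ⟨k, rfl⟩
    exact hg ⟨k, by simp⟩

theorem tsum_enorm_sq_le_of_hasSum {c : ι → H →L[ℂ] H} {S : H →L[ℂ] H}
    (hS : ∀ v, HasSum (fun k => ContinuousLinearMap.adjoint (c k) (c k v)) (S v)) (v : H) :
    ∑' k, ‖c k v‖ₑ ^ 2 ≤ (NNReal.sqrt ‖S‖₊ * ‖v‖ₑ) ^ 2 := by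
  have h1 : HasSum (fun k => ‖c k v‖ ^ 2) (RCLike.re (inner ℂ v (S v))) := by
    have := ((hS v).mapL (innerSL ℂ v)).mapL (RCLike.reCLM (K := ℂ))
    have hk : ∀ k, RCLike.re (inner ℂ v (ContinuousLinearMap.adjoint (c k) (c k v))) =
        ‖c k v‖ ^ 2 := fun k => by
      rw [ContinuousLinearMap.adjoint_inner_right]
      exact inner_self_eq_norm_sq (𝕜 := ℂ) _
    rw [← funext hk]
    exact this
  have h2 : RCLike.re (inner ℂ v (S v)) ≤ ‖S‖ * ‖v‖ ^ 2 :=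
    calc _ ≤ ‖v‖ * ‖S v‖ := re_inner_le_norm _ _
      _ ≤ ‖v‖ * (‖S‖ * ‖v‖) := by gcongr; exact S.le_opNorm v
      _ = _ := by ring
  calc ∑' k, ‖c k v‖ₑ ^ 2 = ENNReal.ofReal (RCLike.re (inner ℂ v (S v))) := by
        rw [← h1.tsum_eq, ENNReal.ofReal_tsum_of_nonneg (fun _ => by positivity) h1.summable]
        exact tsum_congr fun i => by rw [← ofReal_norm, ← ENNReal.ofReal_pow (norm_nonneg _)]
    _ ≤ ENNReal.ofReal (‖S‖ * ‖v‖ ^ 2) := ENNReal.ofReal_le_ofReal h2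
    _ = _ := by
        rw [ENNReal.ofReal_mul (norm_nonneg _), ENNReal.ofReal_pow (norm_nonneg _), ofReal_norm,
          ofReal_norm, mul_pow, ← ENNReal.coe_pow, NNReal.sq_sqrt, enorm_eq_nnnorm]

theorem bmoColNorm_sq_le {ψ : G → ℝ} {x : G → H →L[ℂ] H} (hx : MemColumnL2 x) {N : ℝ≥0∞}
    (hN : ∀ t, 0 < t → vnNorm (heat ψ t (absSq (x - heat ψ t x))) ≤ N) :
    bmoColNorm ψ x ^ 2 ≤ N := by
  rw [bmoColNorm, if_pos hx]
  calc _ ≤ (N ^ (1 / 2 : ℝ)) ^ 2 := by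
        gcongr
        exact iSup₂_le fun t ht => ENNReal.rpow_le_rpow (hN t ht) (by norm_num)
    _ = N := by rw [← ENNReal.rpow_natCast, ← ENNReal.rpow_mul]; norm_num

theorem vnNorm_le_bmoColNorm_sq {ψ : G → ℝ} {x : G → H →L[ℂ] H} (hx : MemColumnL2 x) {t : ℝ}
    (ht : 0 < t) : vnNorm (heat ψ t (absSq (x - heat ψ t x))) ≤ bmoColNorm ψ x ^ 2 := by
  rw [bmoColNorm, if_pos hx]
  refine le_trans (le_of_eq ?_) (pow_le_pow_left' (le_iSup₂ (f := fun (t : ℝ) (_ : 0 < t) =>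
    vnNorm (heat ψ t (absSq (x - heat ψ t x))) ^ (1 / 2 : ℝ)) t ht) 2)
  rw [← ENNReal.rpow_natCast, ← ENNReal.rpow_mul]; norm_num

open Filter Topology in
theorem tsum_enorm_sq_le_bmoColNorm {ψ : G → ℝ} (hψ : IsCondNegLength ψ) {x : G → H →L[ℂ] H}
    (hx : MemColumnL2 x) (hsupp : ∀ g, x g = 0 ∨ 0 < ψ g) (v : H) :
    ∑' g, ‖x g v‖ₑ ^ 2 ≤ (bmoColNorm ψ x * ‖v‖ₑ) ^ 2 := by
  rw [ENNReal.tsum_eq_iSup_sum]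
  refine iSup_le fun s => ?_
  -- On a finite set of `g` the limit `t → ∞` can be taken termwise; `ψ > 0` on the support makes
  -- every factor `1 - e^{-tψ(g)}` tend to 1.
  have hlim : Tendsto (fun t : ℝ => ∑ g ∈ s, ‖(x - heat ψ t x) g v‖ₑ ^ 2) atTop
      (𝓝 (∑ g ∈ s, ‖x g v‖ₑ ^ 2)) := by
    refine tendsto_finsetSum _ fun g _ => (ENNReal.continuous_pow 2).tendsto _ |>.comp
      ((continuous_enorm.tendsto _).comp ?_)
    simp_rw [sub_heat_apply]
    rcases hsupp g with h0 | hg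
    · simp [h0]
    · have h1 : Tendsto (fun t : ℝ => 1 - Real.exp (-t * ψ g)) atTop (𝓝 (1 - 0)) := by
        refine tendsto_const_nhds.sub (Real.tendsto_exp_atBot.comp ?_)
        simp_rw [neg_mul]
        exact tendsto_neg_atTop_atBot.comp (tendsto_id.atTop_mul_const hg)
      have h2 := ((Complex.continuous_ofReal.tendsto _).comp h1).smul_const (x g v)
      simpa using h2
  refine le_of_tendsto hlim ?_
  filter_upwards [eventually_gt_atTop 0] with t ht
  calc _ ≤ ∑' g, ‖(x - heat ψ t x) g v‖ₑ ^ 2 := ENNReal.sum_le_tsum s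
    _ ≤ vnNorm (heat ψ t (absSq (x - heat ψ t x))) * ‖v‖ₑ ^ 2 :=
        tsum_enorm_sq_le_vnNorm hψ.map_one t (hx.sub_heat hψ.nonneg ht) v
    _ ≤ bmoColNorm ψ x ^ 2 * ‖v‖ₑ ^ 2 := by gcongr; exact vnNorm_le_bmoColNorm_sq hx ht
    _ = _ := by ring

theorem sqSumNorm_le_bmoColNorm_sq {ψ : G → ℝ} (hψ : IsCondNegLength ψ) {h : ι → G}
    (hinj : Function.Injective h) (hpos : ∀ k, 0 < ψ (h k)) (c : ι → H →L[ℂ] H) :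
    sqSumNorm c ≤ bmoColNorm ψ (series c h) ^ 2 := by
  by_cases hN : bmoColNorm ψ (series c h) = ∞
  · simp [hN]
  have hx : MemColumnL2 (series c h) := by
    by_contra hx
    exact hN (by rw [bmoColNorm, if_neg hx])
  have hsupp : ∀ g, series c h g = 0 ∨ 0 < ψ g := fun g => by
    by_cases hg : g ∈ Set.range h
    · obtain ⟨k, rfl⟩ := hg
      exact Or.inr (hpos k)
    · exact Or.inl (series_of_notMem_range c hg)
  have hb := tsum_enorm_sq_le_bmoColNorm hψ hx hsupp
  lift bmoColNorm ψ (series c h) to ℝ≥0 using hN with N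
  simp_rw [tsum_enorm_series hinj] at hb
  obtain ⟨Y, hY, hYn⟩ := exists_clm_lp
    (LinearMap.pi fun k => (c k : H →ₗ[ℂ] H)) N (fun v => by simpa using hb v)
  have hY' : ∀ v k, Y v k = c k v := fun v k => by rw [hY]; rfl
  refine (iInf₂_le (f := fun (S : H →L[ℂ] H)
    (_ : ∀ v, HasSum (fun k => ContinuousLinearMap.adjoint (c k) (c k v)) (S v)) => ‖S‖ₑ)
    ((ContinuousLinearMap.adjoint Y).comp Y) fun v => ?_).trans ?_
  · have := hasSum_adjoint_column hY' (Y v)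
    simp only [hY'] at this
    exact this
  · rw [← ofReal_norm, ContinuousLinearMap.norm_adjoint_comp_self,
      ENNReal.ofReal_mul (norm_nonneg _), ofReal_norm, ← sq]
    gcongr

theorem bmoColNorm_series_sq_le [LinearOrder ι] {ψ : G → ℝ} (hψ : IsCondNegLength ψ) {δ η : ℝ}
    (hδ : 0 < δ) (hη : 0 < η) {h : ι → G} (hinj : Function.Injective h)
    (hgrow : ∀ k l, k < l → (1 + δ) * ψ (h k) ≤ ψ (h l))
    (hsep : ∀ k l, k ≠ l → η * ψ (h l) ≤ ψ ((h k)⁻¹ * h l)) (c : ι → H →L[ℂ] H) :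
    bmoColNorm ψ (series c h) ^ 2 ≤
      ((2 * (1 + (lacunaryConst δ η).toNNReal) : ℝ≥0) : ℝ≥0∞) * sqSumNorm c := by
  classical
  rw [mul_comm, ← ENNReal.div_le_iff (by simp) ENNReal.coe_ne_top]
  refine le_iInf₂ fun S hS => ?_
  rw [ENNReal.div_le_iff (by simp) ENNReal.coe_ne_top]
  have hb : ∀ v, ∑' g, ‖series c h g v‖ₑ ^ 2 ≤ (NNReal.sqrt ‖S‖₊ * ‖v‖ₑ) ^ 2 := fun v => by
    rw [tsum_enorm_series hinj]
    exact tsum_enorm_sq_le_of_hasSum hS v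
  have hx : MemColumnL2 (series c h) := fun v => (tsum_enorm_sq_ne_top_iff _).1
    (ne_top_of_le_ne_top (by simp [ENNReal.mul_eq_top]) (hb v))
  refine bmoColNorm_sq_le hx fun t ht => ?_
  have he : ∀ g, 0 ≤ 1 - Real.exp (-t * ψ g) := fun g =>
    sub_nonneg.2 (Real.exp_le_one_iff.2 (by nlinarith [hψ.nonneg g]))
  have he1 : ∀ g, 1 - Real.exp (-t * ψ g) ≤ 1 := fun g => by linarith [Real.exp_pos (-t * ψ g)]
  have he2 : ∀ g, 1 - Real.exp (-t * ψ g) ≤ t * ψ g := fun g => by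
    linarith [Real.add_one_le_exp (-t * ψ g)]
  let w : G → G → ℝ := fun g g' =>
    (1 - Real.exp (-t * ψ g)) * (1 - Real.exp (-t * ψ g')) * Real.exp (-t * ψ (g⁻¹ * g'))
  have hw : ∀ g g', 0 ≤ w g g' := fun g g' =>
    mul_nonneg (mul_nonneg (he g) (he g')) (Real.exp_pos _).le
  have hwsymm : ∀ g g', w g g' = w g' g := fun g g' => by
    have : ψ (g⁻¹ * g') = ψ (g'⁻¹ * g) := by rw [← hψ.map_inv]; simp
    simp only [w, this]
    ring
  -- Off the diagonal, one factor is bounded by 1, the other by `tψ(h_l)`, and the exponential by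
  -- separation.
  have hwle : ∀ k l, w (h k) (h l) ≤ (if l = k then 1 else 0) +
      t * ψ (h l) * Real.exp (-(η * (t * ψ (h l)))) := fun k l => by
    have h0 : 0 ≤ t * ψ (h l) := mul_nonneg ht.le (hψ.nonneg _)
    split_ifs with hlk
    · have h1 : w (h k) (h l) ≤ 1 := mul_le_one₀ (mul_le_one₀ (he1 _) (he _) (he1 _))
        (Real.exp_pos _).le (Real.exp_le_one_iff.2 (by nlinarith [hψ.nonneg ((h k)⁻¹ * h l)]))
      have : 0 ≤ t * ψ (h l) * Real.exp (-(η * (t * ψ (h l)))) := by positivity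
      linarith
    · rw [zero_add]
      have h1 : -t * ψ ((h k)⁻¹ * h l) ≤ -(η * (t * ψ (h l))) := by
        nlinarith [hsep k l (Ne.symm hlk)]
      exact mul_le_mul ((mul_le_of_le_one_left (he _) (he1 _)).trans (he2 _))
        (Real.exp_le_exp.2 h1) (Real.exp_pos _).le h0
  let K : G → G → ℝ≥0 := fun g g' =>
    if g ∈ Set.range h ∧ g' ∈ Set.range h then (w g g').toNNReal else 0
  have hKsum : ∀ g, ∑' g', (K g g' : ℝ≥0∞) ≤ (1 + (lacunaryConst δ η).toNNReal : ℝ≥0) :=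
    fun g => by
      by_cases hg : g ∈ Set.range h
      swap
      · simp only [K, hg, false_and, if_false, ENNReal.coe_zero, tsum_zero, zero_le]
      obtain ⟨k, rfl⟩ := hg
      rw [← hinj.tsum_eq]
      swap
      · intro g' hg'
        by_contra hr
        exact hg' (by simp only [K]; rw [if_neg fun h => hr h.2, ENNReal.coe_zero])
      calc ∑' l, (K (h k) (h l) : ℝ≥0∞)
          ≤ ∑' l, ((if l = k then 1 else 0) +
            ENNReal.ofReal (t * ψ (h l) * Real.exp (-(η * (t * ψ (h l)))))) := by
            refine ENNReal.tsum_le_tsum fun l => ?_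
            have h1 : (K (h k) (h l) : ℝ≥0∞) = ENNReal.ofReal (w (h k) (h l)) := by
              simp only [K]
              rw [if_pos ⟨⟨k, rfl⟩, ⟨l, rfl⟩⟩]
              rfl
            rw [h1]
            refine (ENNReal.ofReal_le_ofReal (hwle k l)).trans
              (ENNReal.ofReal_add_le.trans_eq ?_)
            congr 1
            split_ifs <;> simp
        _ = 1 + ∑' l, ENNReal.ofReal (t * ψ (h l) * Real.exp (-(η * (t * ψ (h l))))) := by
            rw [ENNReal.tsum_add, tsum_ite_eq]
        _ ≤ 1 + ENNReal.ofReal (lacunaryConst δ η) := by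
            gcongr
            rw [ENNReal.tsum_eq_iSup_sum]
            refine iSup_le fun s => ?_
            have h0 : ∀ l, 0 ≤ t * ψ (h l) := fun l => mul_nonneg ht.le (hψ.nonneg _)
            rw [← ENNReal.ofReal_sum_of_nonneg fun l _ => mul_nonneg (h0 l) (Real.exp_pos _).le]
            refine ENNReal.ofReal_le_ofReal (sum_mul_exp_le_lacunaryConst hδ hη h0 ?_ s)
            intro k l hkl
            nlinarith [hgrow k l hkl]
        _ = _ := by push_cast; rfl
  refine (vnNorm_le_of_schur hb K (fun g g' => ?_) hKsum fun g v => ?_).trans_eq ?_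
  · simp only [K, hwsymm g g', and_comm]
  · simp only [heat, absSq, Pi.smul_apply]
    rw [← tsum_const_smul'']
    refine tsum_congr fun g' => ?_
    rw [sub_heat_apply, sub_heat_apply]
    by_cases hg : g' ∈ Set.range h ∧ g' * g ∈ Set.range h
    · simp only [K, if_pos hg, Real.coe_toNNReal _ (hw _ _)]
      simp only [w, inv_mul_cancel_left]
      rw [map_smulₛₗ]
      simp only [Complex.conj_ofReal, smul_apply, map_smul, smul_smul]
      congr 1
      push_cast
      ring
    · rcases not_and_or.1 hg with h1 | h1 <;> simp [series_of_notMem_range c h1]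
  · rw [← ENNReal.coe_pow, NNReal.sq_sqrt, enorm_eq_nnnorm]
    push_cast
    ring

end Series

end OpFourier

open OpFourier in
theorem mainTheorem1 (δ : ℝ) (hδ : 0 < δ) :
    ∃ C : ℝ≥0, 0 < C ∧ ∀ (G : Type*) [Group G] (ψ : G → ℝ), IsCondNegLength ψ →
      ∀ (I : Set ℕ), I.OrdConnected →
      ∀ h : I → G, IsLacunary ψ δ h → (∀ k, 0 < ψ (h k)) →
      ∀ (H : Type*) [NormedAddCommGroup H] [InnerProductSpace ℂ H] [CompleteSpace H]
        (c : I → H →L[ℂ] H),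
        max (OpFourier.sqSumNorm c)
            (OpFourier.sqSumNorm fun k => ContinuousLinearMap.adjoint (c k)) ≤
          C * OpFourier.bmoNorm ψ (OpFourier.series c h) ^ 2 ∧
        OpFourier.bmoNorm ψ (OpFourier.series c h) ^ 2 ≤
          C * max (OpFourier.sqSumNorm c)
            (OpFourier.sqSumNorm fun k => ContinuousLinearMap.adjoint (c k)) := by
  set η : ℝ := (1 - (√(1 + δ))⁻¹) ^ 2
  have hη : 0 < η := by
    have hr : 1 < √(1 + δ) := by rw [Real.lt_sqrt] <;> linarith
    have := inv_lt_one_of_one_lt₀ hr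
    exact pow_pos (by linarith) 2
  refine ⟨2 * (1 + (lacunaryConst δ η).toNNReal), by positivity, ?_⟩
  intro G _ ψ hψ I hI h hlac hpos H _ _ _ c
  have hgrow := hlac.growth_of_lt hδ hI hpos
  have hsep : ∀ k l : I, k ≠ l → η * ψ (h l) ≤ ψ ((h k)⁻¹ * h l) :=
    fun k l hkl => hψ.separated_of_growth hδ hpos hgrow hkl
  -- Separation excludes repetitions, since `ψ 1 = 0`.
  have hinj : Function.Injective h := fun k l hkl => by
    by_contra hne
    have h1 := hsep k l hne
    rw [hkl, inv_mul_cancel, hψ.map_one] at h1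
    linarith [mul_pos hη (hpos l)]
  have hinj' : Function.Injective fun k => (h k)⁻¹ := inv_injective.comp hinj
  have hpos' : ∀ k, 0 < ψ (h k)⁻¹ := fun k => by rw [hψ.map_inv]; exact hpos k
  have hgrow' : ∀ k l : I, k < l → (1 + δ) * ψ (h k)⁻¹ ≤ ψ (h l)⁻¹ := fun k l hkl => by
    rw [hψ.map_inv, hψ.map_inv]; exact hgrow k l hkl
  have hsq : bmoNorm ψ (series c h) ^ 2 = max (bmoColNorm ψ (series c h) ^ 2)
      (bmoColNorm ψ (series (fun k => ContinuousLinearMap.adjoint (c k)) fun k => (h k)⁻¹) ^ 2) := by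
    rw [bmoNorm, adj_series hinj]
    exact (pow_left_mono 2).map_max
  rw [hsq]
  constructor
  · refine (max_le_max (sqSumNorm_le_bmoColNorm_sq hψ hinj hpos c)
      (sqSumNorm_le_bmoColNorm_sq hψ hinj' hpos' _)).trans (le_mul_of_one_le_left zero_le ?_)
    norm_cast
    rw [mul_add]
    exact le_add_right (by norm_num)
  · rw [mul_max]
    exact max_le_max (bmoColNorm_series_sq_le hψ hδ hη hinj hgrow hsep c)
      (bmoColNorm_series_sq_le hψ hδ hη hinj' hgrow'
        (fun k l hkl => hψ.separated_of_growth hδ hpos' hgrow' hkl) _)
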